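/- Let $K$ be an algebraically closed field and let $X$ be a smooth surface over $K$, i.e. an integral separated scheme of finite type over $K$ that is smooth of relative dimension $2$ (not necessarily projective). Let $f\colon X\dashrightarrow X$ be a rational map over $K$, and let $I(f)$ be its indeterminacy set, the complement of the largest open subset on which $f$ is defined. For a closed point $p$ put $f^0(p)=p$ and $f^{n+1}(p)=f(f^n(p))$ as long as $f^n(p)\notin I(f)$. A *curve* on $X$ is a nonempty finite union of irreducible closed subsets of dimension $1$. For a closed set $C\subseteq X$ let $f(C):=\overline{f(C\setminus I(f))}$, and let $f^a(C)$ be the result of applying this operation $a$ times. The curve $C$ is *periodic* if $f^a(C)=C$ for some integer $a>0$. The point $p$ is *preperiodic* if $f^m(p)=f^n(p)$ for some $0\le m<n$. An *arithmetic progression* is a set $\{an+b\mid n\in\mathbb N\}$ with $a,b\in\mathbb N=\{0,1,2,\dots\}$, where $a=0$ is allowed. Then the following statements are equivalent. 1. The pair $(X,f)$ satisfies the DML property: for every curve $C$ on $X$ and every closed point $p\in X$ such that $f^n(p)\notin I(f)$ for all $n\ge 0$, the set $\{n\in\mathbb N\mid f^n(p)\in C\}$ is a union of at most finitely many arithmetic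 progressions. 2. For every irreducible curve $C$ on $X$ and every closed point $p\in X$ such that $f^n(p)\notin I(f)$ for all $n\ge 0$ and the set $\{n\in\mathbb N\mid f^n(p)\in C\}$ is infinite, $p$ is preperiodic or $C$ is periodic. -/

import Mathlib

universe u

open AlgebraicGeometry

namespace SurfaceDynamics

variable {X : Scheme.{u}}

/-- The indeterminacy set `I(f)`: the complement of the largest open subset on which the rational
map `f` is defined. -/
def indeterminacy (f : X.RationalMap X) : Set X :=
  (f.domain : Set X)ᶜ

/-- The action of a rational self-map on points, as a partial function: `f(x)` is defined exactly
when `x` lies outside `I(f)`. -/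
noncomputable def pointMap [IsReduced X] [X.IsSeparated] (f : X.RationalMap X) : PFun X X :=
  fun x => ⟨x ∈ f.toPartialMap.domain, fun hx => f.toPartialMap.hom ⟨x, hx⟩⟩

/-- The iterates on points: `f^0(x) = x` and `f^(n+1)(x) = f(f^n(x))`. The value `f^n(x)` is
defined exactly when none of `x, f(x), …, f^(n-1)(x)` lies in `I(f)`. -/
noncomputable def iter [IsReduced X] [X.IsSeparated] (f : X.RationalMap X) : ℕ → PFun X X
  | 0 => PFun.id X
  | n + 1 => (pointMap f).comp (iter f n)

/-- The forward orbit of `p` avoids the indeterminacy set: `f^n(p) ∉ I(f)` for all `n ≥ 0`. -/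
def OrbitAvoids [IsReduced X] [X.IsSeparated] (f : X.RationalMap X) (p : X) : Prop :=
  ∀ n : ℕ, ∃ q ∈ iter f n p, q ∉ indeterminacy f

/-- The set of times `{n ∈ ℕ | f^n(p) ∈ C}`. -/
def returnSet [IsReduced X] [X.IsSeparated] (f : X.RationalMap X) (p : X) (C : Set X) : Set ℕ :=
  {n | ∃ q ∈ iter f n p, q ∈ C}

/-- `p` is preperiodic: `f^m(p) = f^n(p)` for some `m < n`. -/
def IsPreperiodic [IsReduced X] [X.IsSeparated] (f : X.RationalMap X) (p : X) : Prop :=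
  ∃ m n : ℕ, m < n ∧ ∃ q, q ∈ iter f m p ∧ q ∈ iter f n p

/-- The strict transform `f(C)`, the closure of `f(C \ I(f))`. -/
def strictTransform [IsReduced X] [X.IsSeparated] (f : X.RationalMap X) (C : Set X) : Set X :=
  closure ((pointMap f).image (C \ indeterminacy f))

/-- `C` is periodic: `f^a(C) = C` for some `a > 0`, where `f^a(C)` is the `a`-fold iterated strict
transform. -/
def IsPeriodicCurve [IsReduced X] [X.IsSeparated] (f : X.RationalMap X) (C : Set X) : Prop :=
  ∃ a : ℕ, 0 < a ∧ (strictTransform f)^[a] C = C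

/-- An irreducible curve: an irreducible closed subset of dimension one. -/
structure IsIrreducibleCurve (C : Set X) : Prop where
  isClosed : IsClosed C
  isIrreducible : IsIrreducible C
  dim_eq_one : topologicalKrullDim C = 1

/-- A curve, possibly reducible: a nonempty finite union of irreducible curves. -/
def IsCurve (C : Set X) : Prop :=
  ∃ T : Set (Set X), T.Finite ∧ T.Nonempty ∧ (∀ Z ∈ T, IsIrreducibleCurve Z) ∧ C = ⋃₀ T

/-- A union of at most finitely many arithmetic progressions `{a n + b | n ∈ ℕ}` with
`a, b ∈ ℕ`, where `a = 0` is allowed. -/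
def IsFiniteUnionOfAP (S : Set ℕ) : Prop :=
  ∃ T : Finset (ℕ × ℕ), S = {m | ∃ ab ∈ T, ∃ n : ℕ, m = ab.1 * n + ab.2}

/-- The DML property of the pair `(X, f)`. -/
def HasDML [IsReduced X] [X.IsSeparated] (f : X.RationalMap X) : Prop :=
  ∀ C : Set X, IsCurve C → ∀ p : X, IsClosed {p} → OrbitAvoids f p →
    IsFiniteUnionOfAP (returnSet f p C)

end SurfaceDynamics

/-! Suppose the return set of `p` to an irreducible curve `C` is infinite and `p` is not
preperiodic. If the return set contains a progression of step `a > 0`, the points of the orbit at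
these times, and those `a` steps later, form two infinite subsets of `C`; both are dense in `C`, and
continuity of `f^a` turns this into `f^a(C) = C`. Conversely, if `p` is preperiodic or `C` is
periodic, the return set is eventually stable under adding some `a > 0`, hence a finite union of
progressions. -/

open TopologicalSpace

namespace SurfaceDynamics

section ArithmeticProgressions

variable {S : Set ℕ} {a : ℕ}

lemma IsFiniteUnionOfAP.of_finite (hS : S.Finite) : IsFiniteUnionOfAP S :=
  ⟨hS.toFinset.image fun b => (0, b), by ext; simp⟩

lemma IsFiniteUnionOfAP.union {T : Set ℕ} (hS : IsFiniteUnionOfAP S) (hT : IsFiniteUnionOfAP T) :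
    IsFiniteUnionOfAP (S ∪ T) := by
  obtain ⟨s, rfl⟩ := hS
  obtain ⟨t, rfl⟩ := hT
  refine ⟨s ∪ t, Set.ext fun m => ?_⟩
  simp only [Set.mem_union, Set.mem_ofPred_eq, Finset.mem_union, or_and_right, exists_or]

lemma IsFiniteUnionOfAP.biUnion {ι : Type*} {I : Set ι} (hI : I.Finite) {S : ι → Set ℕ}
    (h : ∀ i ∈ I, IsFiniteUnionOfAP (S i)) : IsFiniteUnionOfAP (⋃ i ∈ I, S i) := by
  induction I, hI using Set.Finite.induction_on with
  | empty => simpa using of_finite Set.finite_empty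
  | insert _ _ ih =>
    rw [Set.biUnion_insert]
    exact (h _ (Set.mem_insert _ _)).union (ih fun i hi => h i (Set.mem_insert_of_mem _ hi))

lemma IsFiniteUnionOfAP.of_add_mem_of_modEq (hadd : ∀ n ∈ S, n + a ∈ S)
    (hmod : ∀ m ∈ S, ∀ n ∈ S, m ≡ n [MOD a]) : IsFiniteUnionOfAP S := by
  rcases S.eq_empty_or_nonempty with rfl | hne
  · exact of_finite Set.finite_empty
  have hmin : sInf S ∈ S := Nat.sInf_mem hne
  have hmul : ∀ k, a * k + sInf S ∈ S := fun k => by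
    induction k with
    | zero => simpa using hmin
    | succ k ih => simpa only [Nat.mul_succ, Nat.add_right_comm] using hadd _ ih
  refine ⟨{(a, sInf S)}, Set.ext fun n => ⟨fun hn => ?_, ?_⟩⟩
  · have hle : sInf S ≤ n := Nat.sInf_le hn
    obtain ⟨k, hk⟩ := (Nat.modEq_iff_dvd' hle).1 (hmod _ hmin n hn)
    exact ⟨(a, sInf S), Finset.mem_singleton_self _, k, by dsimp only; omega⟩
  · rintro ⟨_, hab, k, rfl⟩
    rw [Finset.mem_singleton.1 hab]
    exact hmul k

lemma IsFiniteUnionOfAP.of_eventually_add_mem {N : ℕ} (ha : 0 < a)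
    (h : ∀ n ∈ S, N ≤ n → n + a ∈ S) : IsFiniteUnionOfAP S := by
  have hS : S = S ∩ Set.Iio N ∪ ⋃ r ∈ Set.Iio a, {n | n ∈ S ∧ N ≤ n ∧ n % a = r} := by
    refine Set.Subset.antisymm (fun n hn => ?_) (Set.union_subset Set.inter_subset_left ?_)
    · exact (lt_or_ge n N).imp (fun hN => ⟨hn, hN⟩)
        fun hN => Set.mem_biUnion (Nat.mod_lt n ha) ⟨hn, hN, rfl⟩
    · exact Set.iUnion₂_subset fun _ _ _ hn => hn.1
  rw [hS]
  refine (of_finite ((Set.finite_Iio N).inter_of_right S)).union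
    (biUnion (Set.finite_Iio a) fun r _ => of_add_mem_of_modEq (a := a) ?_ ?_)
  · rintro n ⟨hn, hNn, hr⟩
    exact ⟨h n hn hNn, by omega, by rwa [Nat.add_mod_right]⟩
  · rintro m ⟨-, -, hm⟩ n ⟨-, -, hn⟩
    exact hm.trans hn.symm

lemma IsFiniteUnionOfAP.exists_progression_subset (hS : IsFiniteUnionOfAP S) (hinf : S.Infinite) :
    ∃ a b : ℕ, 0 < a ∧ ∀ n, a * n + b ∈ S := by
  obtain ⟨T, rfl⟩ := hS
  by_contra! hne
  refine hinf ((T.finite_toSet.image Prod.snd).subset ?_)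
  rintro _ ⟨⟨a, b⟩, hab, n, rfl⟩
  have ha : a = 0 := by
    by_contra ha
    obtain ⟨k, hk⟩ := hne a b (Nat.pos_of_ne_zero ha)
    exact hk ⟨(a, b), hab, k, rfl⟩
  exact ⟨(a, b), hab, by simp [ha]⟩

lemma IsFiniteUnionOfAP.exists_infinite_add_mem (hS : IsFiniteUnionOfAP S) (hinf : S.Infinite) :
    ∃ a, 0 < a ∧ {n | n ∈ S ∧ n + a ∈ S}.Infinite := by
  obtain ⟨a, b, ha, hab⟩ := hS.exists_progression_subset hinf
  have hinj : Function.Injective fun n => a * n + b := fun m n h =>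
    Nat.eq_of_mul_eq_mul_left ha (Nat.add_right_cancel h)
  refine ⟨a, ha, (Set.infinite_range_of_injective hinj).mono ?_⟩
  rintro _ ⟨n, rfl⟩
  exact ⟨hab n, by simpa only [Nat.mul_succ, Nat.add_right_comm] using hab (n + 1)⟩

end ArithmeticProgressions

section NoetherianSpaces

variable {Y : Type*} [TopologicalSpace Y]

lemma exists_infinite_isIrreducible_subset_closure [NoetherianSpace Y] {S : Set Y}
    (hS : S.Infinite) :
    ∃ W ⊆ closure S, W.Infinite ∧ IsClosed W ∧ IsIrreducible W := by
  obtain ⟨T, hT, hTc, hTi, hST⟩ :=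
    NoetherianSpace.exists_finite_set_isClosed_irreducible (isClosed_closure (s := S))
  by_contra! hne
  refine hS (Set.Finite.subset ?_ subset_closure)
  rw [hST]
  refine hT.sUnion fun W hW => by_contra fun hWinf => ?_
  exact hne W (hST ▸ Set.subset_sUnion_of_mem hW) hWinf (hTc W hW) (hTi W hW)

lemma subsingleton_of_isMin_irreducibleCloseds [T0Space Y] {W : IrreducibleCloseds Y}
    (hW : IsMin W) : (W : Set Y).Subsingleton := by
  refine minimal_nonempty_closed_subsingleton W.isClosed fun t htW ⟨x, hx⟩ ht => htW.antisymm ?_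
  have hxt : closure {x} ⊆ t := closure_minimal (Set.singleton_subset_iff.2 hx) ht
  have hWx : (W : Set Y) ⊆ closure {x} :=
    @hW ⟨closure {x}, isIrreducible_singleton.closure, isClosed_closure⟩ (hxt.trans htW)
  exact hWx.trans hxt

lemma dense_of_infinite_of_topologicalKrullDim_le_one [NoetherianSpace Y] [T0Space Y]
    [IrreducibleSpace Y] (hdim : topologicalKrullDim Y ≤ 1) {S : Set Y} (hS : S.Infinite) :
    Dense S := by
  obtain ⟨W, hWS, hWinf, hWc, hWi⟩ := exists_infinite_isIrreducible_subset_closure hS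
  rcases Order.krullDim_le_one_iff.1 hdim ⟨W, hWi, hWc⟩ with hmin | hmax
  · exact absurd (subsingleton_of_isMin_irreducibleCloseds hmin).finite hWinf
  · have hW : Set.univ ⊆ W :=
      @hmax ⟨Set.univ, IrreducibleSpace.isIrreducible_univ Y, isClosed_univ⟩ (Set.subset_univ W)
    exact fun y => hWS (hW (Set.mem_univ y))

end NoetherianSpaces

section PartialFunctions

variable {α β γ : Type*}

lemma mem_pfunComp {h : β →. γ} {g : α →. β} {x : α} {z : γ} :
    z ∈ h.comp g x ↔ ∃ y ∈ g x, z ∈ h y :=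
  Part.mem_bind_iff

lemma image_pfunComp (h : β →. γ) (g : α →. β) (S : Set α) :
    (h.comp g).image S = h.image (g.image S) := by
  ext z
  simp only [PFun.mem_image, mem_pfunComp]
  exact ⟨fun ⟨x, hx, y, hy, hz⟩ => ⟨y, ⟨x, hx, hy⟩, hz⟩,
    fun ⟨y, ⟨x, hx, hy⟩, hz⟩ => ⟨x, hx, y, hy, hz⟩⟩

variable [TopologicalSpace α] [TopologicalSpace β] [TopologicalSpace γ]

lemma pContinuous_comp {h : β →. γ} {g : α →. β} (hh : PContinuous h) (hg : PContinuous g) :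
    PContinuous (h.comp g) := fun V hV => by
  rw [PFun.preimage_comp]
  exact hg _ (hh V hV)

lemma closure_image_closure_of_pContinuous {g : α →. β} (hg : PContinuous g) (S : Set α) :
    closure (g.image (closure S)) = closure (g.image S) := by
  refine (closure_minimal ?_ isClosed_closure).antisymm
    (closure_mono (PFun.image_mono _ subset_closure))
  rintro y ⟨x, hx, hxy⟩
  refine mem_closure_iff.2 fun V hV hyV => ?_
  obtain ⟨s, ⟨z, hzV, hsz⟩, hsS⟩ := mem_closure_iff.1 hx _ (hg V hV) ⟨y, hyV, hxy⟩
  exact ⟨z, hzV, s, hsS, hsz⟩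

end PartialFunctions

section Iterates

variable {X : Scheme.{u}} [IsReduced X] [X.IsSeparated] (f : X.RationalMap X)

lemma pContinuous_pointMap : PContinuous (pointMap f) := fun V hV => by
  have hpre : (pointMap f).preimage V =
      Subtype.val '' (f.toPartialMap.hom ⁻¹' V : Set f.toPartialMap.domain) := by
    ext x
    exact ⟨fun ⟨_, hyV, hx, hxy⟩ => ⟨⟨x, hx⟩, (congrArg (· ∈ V) hxy).mpr hyV, rfl⟩,
      fun ⟨⟨_, hx⟩, hxV, hxx⟩ => hxx ▸ ⟨_, hxV, hx, rfl⟩⟩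
  rw [hpre]
  exact f.toPartialMap.domain.isOpen.isOpenMap_subtype_val _
    (hV.preimage f.toPartialMap.hom.continuous)

lemma pContinuous_iter (n : ℕ) : PContinuous (iter f n) := by
  induction n with
  | zero => exact fun V hV => (PFun.coe_preimage _root_.id V).symm ▸ hV
  | succ n ih => exact pContinuous_comp (pContinuous_pointMap f) ih

lemma iter_add (m n : ℕ) : iter f (m + n) = (iter f n).comp (iter f m) := by
  induction n with
  | zero => exact (PFun.id_comp _).symm
  | succ n ih =>
    rw [← Nat.add_assoc, iter, ih, iter, PFun.comp_assoc]

variable {f}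

lemma mem_iter_add {m n : ℕ} {x y z : X} (hy : y ∈ iter f m x) :
    z ∈ iter f (m + n) x ↔ z ∈ iter f n y := by
  rw [iter_add, mem_pfunComp]
  exact ⟨fun ⟨_, hy', hz⟩ => Part.mem_unique hy' hy ▸ hz, fun hz => ⟨y, hy, hz⟩⟩

lemma strictTransform_eq_closure_image (C : Set X) :
    strictTransform f C = closure ((pointMap f).image C) := by
  refine congrArg closure ((PFun.image_mono _ Set.sdiff_subset).antisymm ?_)
  rintro y ⟨x, hx, hxd, hxy⟩
  exact ⟨x, ⟨hx, not_not_intro hxd⟩, hxd, hxy⟩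

lemma iterate_strictTransform {n : ℕ} (hn : 0 < n) (C : Set X) :
    (strictTransform f)^[n] C = closure ((iter f n).image C) := by
  induction n, hn using Nat.le_induction with
  | base =>
    rw [Function.iterate_one, strictTransform_eq_closure_image]
    simp only [iter, PFun.comp_id]
  | succ n _ ih =>
    rw [Function.iterate_succ_apply', ih, strictTransform_eq_closure_image,
      closure_image_closure_of_pContinuous (pContinuous_pointMap f), iter, image_pfunComp]

lemma isPeriodicCurve_iff {C : Set X} :
    IsPeriodicCurve f C ↔ ∃ a, 0 < a ∧ closure ((iter f a).image C) = C :=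
  exists_congr fun _ => and_congr_right fun ha => by rw [iterate_strictTransform ha]

end Iterates

section Orbits

variable {X : Scheme.{u}} [IsReduced X] [X.IsSeparated] {f : X.RationalMap X} {p : X} {C : Set X}
  {T : Set ℕ}

lemma returnSet_sUnion (𝒞 : Set (Set X)) :
    returnSet f p (⋃₀ 𝒞) = ⋃ Z ∈ 𝒞, returnSet f p Z := by
  ext n
  simp only [returnSet, Set.mem_sUnion, Set.mem_iUnion, Set.mem_ofPred_eq, exists_prop]
  exact ⟨fun ⟨y, hy, Z, hZ, hyZ⟩ => ⟨Z, hZ, y, hy, hyZ⟩,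
    fun ⟨Z, hZ, y, hy, hyZ⟩ => ⟨y, hy, Z, hZ, hyZ⟩⟩

lemma IsPreperiodic.isFiniteUnionOfAP_returnSet (hp : IsPreperiodic f p) (C : Set X) :
    IsFiniteUnionOfAP (returnSet f p C) := by
  obtain ⟨m, n, hmn, x, hxm, hxn⟩ := hp
  refine .of_eventually_add_mem (N := m) (Nat.sub_pos_of_lt hmn) ?_
  rintro i ⟨y, hy, hyC⟩ hmi
  obtain ⟨k, rfl⟩ := Nat.exists_eq_add_of_le hmi
  rw [show m + k + (n - m) = n + k by omega]
  exact ⟨y, (mem_iter_add hxn).2 ((mem_iter_add hxm).1 hy), hyC⟩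

lemma IsPeriodicCurve.isFiniteUnionOfAP_returnSet (hC : IsPeriodicCurve f C)
    (hp : OrbitAvoids f p) : IsFiniteUnionOfAP (returnSet f p C) := by
  obtain ⟨a, ha, hCa⟩ := isPeriodicCurve_iff.1 hC
  refine .of_eventually_add_mem (N := 0) ha ?_
  rintro n ⟨y, hy, hyC⟩ -
  obtain ⟨z, hz, -⟩ := hp (n + a)
  exact ⟨z, hz, hCa ▸ subset_closure ⟨y, hyC, (mem_iter_add hy).1 hz⟩⟩

/-- The part of the forward orbit of `p` visited at the times in `T`; times at which the iterate is
undefined contribute nothing. -/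
def orbitAt (f : X.RationalMap X) (p : X) (T : Set ℕ) : Set X :=
  {y | ∃ n ∈ T, y ∈ iter f n p}

lemma orbitAt_subset (hT : T ⊆ returnSet f p C) : orbitAt f p T ⊆ C := by
  rintro y ⟨n, hn, hy⟩
  obtain ⟨z, hz, hzC⟩ := hT hn
  exact Part.mem_unique hz hy ▸ hzC

lemma image_iter_orbitAt (a : ℕ) :
    (iter f a).image (orbitAt f p T) = orbitAt f p ((· + a) '' T) := by
  ext z
  simp only [orbitAt, PFun.mem_image, Set.mem_ofPred_eq, Set.exists_mem_image, iter_add,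
    mem_pfunComp]
  exact ⟨fun ⟨y, ⟨n, hn, hy⟩, hz⟩ => ⟨n, hn, y, hy, hz⟩,
    fun ⟨n, hn, y, hy, hz⟩ => ⟨y, ⟨n, hn, hy⟩, hz⟩⟩

lemma infinite_orbitAt (hT : T.Infinite) (hdom : ∀ n ∈ T, (iter f n p).Dom)
    (hp : ¬ IsPreperiodic f p) : (orbitAt f p T).Infinite := by
  have : Nonempty X := ⟨p⟩
  choose! q hq using fun n hn => Part.dom_iff_mem.1 (hdom n hn)
  have hlt : ∀ m ∈ T, ∀ n ∈ T, q m = q n → ¬ m < n := fun m hm n hn h hmn =>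
    hp ⟨m, n, hmn, q m, hq m hm, h ▸ hq n hn⟩
  have hinj : Set.InjOn q T := fun m hm n hn h =>
    (not_lt.1 (hlt n hn m hm h.symm)).antisymm (not_lt.1 (hlt m hm n hn h))
  exact (hT.image hinj).mono (Set.image_subset_iff.2 fun n hn => ⟨n, hn, hq n hn⟩)

end Orbits

section IrreducibleCurves

variable {X : Scheme.{u}} {C : Set X}

lemma IsIrreducibleCurve.isCurve (hC : IsIrreducibleCurve C) : IsCurve C :=
  ⟨{C}, Set.finite_singleton C, Set.singleton_nonempty C, by simpa using hC, by simp⟩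

variable [NoetherianSpace X]

lemma IsIrreducibleCurve.closure_eq_of_infinite (hC : IsIrreducibleCurve C) {S : Set X}
    (hSC : S ⊆ C) (hS : S.Infinite) : closure S = C := by
  have : IrreducibleSpace C := isIrreducible_iff_irreducibleSpace.1 hC.isIrreducible
  have hdense : Dense ((↑) ⁻¹' S : Set C) :=
    dense_of_infinite_of_topologicalKrullDim_le_one hC.dim_eq_one.le
      (hS.preimage (by rwa [Subtype.range_coe]))
  exact (closure_minimal hSC hC.isClosed).antisymm
    ((Subtype.dense_iff.1 hdense).trans (closure_mono (Set.image_preimage_subset _ _)))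

variable [IsReduced X] [X.IsSeparated] {f : X.RationalMap X} {p : X}

lemma IsIrreducibleCurve.closure_orbitAt (hC : IsIrreducibleCurve C) (hp : ¬ IsPreperiodic f p)
    {T : Set ℕ} (hTC : T ⊆ returnSet f p C) (hT : T.Infinite) : closure (orbitAt f p T) = C :=
  hC.closure_eq_of_infinite (orbitAt_subset hTC) <|
    infinite_orbitAt hT (fun _ hn => (hTC hn).elim fun _ hy => Part.dom_iff_mem.2 ⟨_, hy.1⟩) hp

lemma IsIrreducibleCurve.isPeriodicCurve_of_infinite_add_mem (hC : IsIrreducibleCurve C)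
    (hp : ¬ IsPreperiodic f p) {a : ℕ} (ha : 0 < a)
    (hinf : {n | n ∈ returnSet f p C ∧ n + a ∈ returnSet f p C}.Infinite) :
    IsPeriodicCurve f C := by
  set T := {n | n ∈ returnSet f p C ∧ n + a ∈ returnSet f p C}
  have hT : closure (orbitAt f p T) = C := hC.closure_orbitAt hp (fun _ hn => hn.1) hinf
  have hTa : closure (orbitAt f p ((· + a) '' T)) = C :=
    hC.closure_orbitAt hp (Set.image_subset_iff.2 fun _ hn => hn.2)
      (hinf.image (add_left_injective a).injOn)
  refine isPeriodicCurve_iff.2 ⟨a, ha, ?_⟩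
  calc closure ((iter f a).image C)
      = closure ((iter f a).image (closure (orbitAt f p T))) := by rw [hT]
    _ = closure ((iter f a).image (orbitAt f p T)) :=
        closure_image_closure_of_pContinuous (pContinuous_iter f a) _
    _ = C := by rw [image_iter_orbitAt, hTa]

lemma IsIrreducibleCurve.isFiniteUnionOfAP_returnSet_iff (hC : IsIrreducibleCurve C)
    (hp : OrbitAvoids f p) :
    IsFiniteUnionOfAP (returnSet f p C) ↔
      ((returnSet f p C).Infinite → IsPreperiodic f p ∨ IsPeriodicCurve f C) := by
  refine ⟨fun h hinf => or_iff_not_imp_left.2 fun hpre => ?_, fun h => ?_⟩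
  · obtain ⟨a, ha, hinf'⟩ := h.exists_infinite_add_mem hinf
    exact hC.isPeriodicCurve_of_infinite_add_mem hpre ha hinf'
  · by_cases hfin : (returnSet f p C).Finite
    · exact .of_finite hfin
    · rcases h hfin with hpre | hper
      · exact hpre.isFiniteUnionOfAP_returnSet C
      · exact hper.isFiniteUnionOfAP_returnSet hp

end IrreducibleCurves

lemma noetherianSpace_of_locallyOfFiniteType {X Y : Scheme.{u}} (g : X ⟶ Y)
    [LocallyOfFiniteType g] [QuasiCompact g] [IsNoetherian Y] : NoetherianSpace X := by
  have : CompactSpace X := QuasiCompact.compactSpace_of_compactSpace g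
  have : IsNoetherian X := { __ := LocallyOfFiniteType.isLocallyNoetherian g }
  infer_instance

end SurfaceDynamics

theorem proposition4p2_general (X : Scheme.{u}) [IsReduced X] [X.IsSeparated] [NoetherianSpace X]
    (f : X.RationalMap X) :
    SurfaceDynamics.HasDML f ↔
      ∀ C : Set X, SurfaceDynamics.IsIrreducibleCurve C →
        ∀ p : X, IsClosed {p} → SurfaceDynamics.OrbitAvoids f p →
          (SurfaceDynamics.returnSet f p C).Infinite →
            SurfaceDynamics.IsPreperiodic f p ∨ SurfaceDynamics.IsPeriodicCurve f C := by
  constructor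
  · exact fun h C hC p hpc hp =>
      (hC.isFiniteUnionOfAP_returnSet_iff hp).1 (h C hC.isCurve p hpc hp)
  · rintro h _ ⟨𝒞, hfin, -, hcurve, rfl⟩ p hpc hp
    rw [SurfaceDynamics.returnSet_sUnion]
    exact .biUnion hfin fun Z hZ =>
      ((hcurve Z hZ).isFiniteUnionOfAP_returnSet_iff hp).2 (h Z (hcurve Z hZ) p hpc hp)

theorem proposition4p2 {K : Type u} [Field K] [IsAlgClosed K]
    (X : Scheme.{u}) [X.Over (Spec (CommRingCat.of K))]
    [IsIntegral X] [X.IsSeparated] [QuasiCompact (X ↘ Spec (CommRingCat.of K))]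
    [SmoothOfRelativeDimension 2 (X ↘ Spec (CommRingCat.of K))]
    (f : X.RationalMap X) [f.IsOver (Spec (CommRingCat.of K))] :
    SurfaceDynamics.HasDML f ↔
      ∀ C : Set X, SurfaceDynamics.IsIrreducibleCurve C →
        ∀ p : X, IsClosed {p} → SurfaceDynamics.OrbitAvoids f p →
          (SurfaceDynamics.returnSet f p C).Infinite →
            SurfaceDynamics.IsPreperiodic f p ∨ SurfaceDynamics.IsPeriodicCurve f C := by
  have : Smooth (X ↘ Spec (CommRingCat.of K)) := SmoothOfRelativeDimension.smooth 2 _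
  have := SurfaceDynamics.noetherianSpace_of_locallyOfFiniteType (X ↘ Spec (CommRingCat.of K))
  exact proposition4p2_general X f
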